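/- All logarithms are to base $2$ unless written otherwise. Let $d\ge 4$ be real and let $k$ be the integer obtained by rounding $2^{2d/3}$ up or down. The algorithm $\mathsf{FirstDiff}[d]$ with at most $k$ probes per ball places balls one after the other into $n$ initially empty bins. Each ball probes bins chosen independently and uniformly at random (with replacement). It stops as soon as it probes an empty bin, and is placed there, or as soon as it probes a bin whose load differs from that of a bin it probed before, and is then placed in a least loaded one of the bins it probed (ties are broken by an arbitrary rule depending on what has been observed so far). If neither happens within $k$ probes, the ball is placed in the last probed bin. Use this algorithm to place $n\ge 1$ balls into $n$ bins. Let $X$ be the total number of probes made and $L$ the maximum load of a bin after all $n$ balls are placed. 1. $\mathbf{E}[X/n]\le d$. 2. There are absolute constants $c>0$ and $A$ (independent of $d$, $n$, the rounding and the tie-breaking rule) such that $\Pr[X/n> d]\le A\,n^{-c}$. 3. Let $n_0$ be the smallest natural number such that $$36\log m\left(\frac{72\,e\log m}{5m}\right)^4\le\frac1{m^2}\qquad\text{for all integers } m>n_0 .$$ There are absolute constants $C$, $c>0$ and $A$ such that, if $n\ge\max(2,n_0)$ and $k=\lceil 2^{2d/3}\rceil$, or $k=\lfloor 2^{2d/3}\rfloor$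 and $k\ge 2^{0.66d}$, then $$\Pr\left[L>\frac{\log\log n}{0.66\,d}+C\right]\le A\,n^{-c}.$$ -/

import Mathlib

open MeasureTheory ProbabilityTheory

namespace FirstDiff

/-- A rule for "breaking ties arbitrarily" among `n` bins.  When a ball has to go to a least loaded
bin among those it probed, `pick past cur s` is the bin that receives it, where `past` lists the
probes made by the earlier balls (most recent ball first; this determines the present loads), `cur`
lists the probes made by the present ball (most recent first), and `s` is the set of
least loaded probed bins.  The rule may be any function of what has been observed so far. -/
structure TieRule (n : ℕ) where
  pick : List (List (Fin n)) → List (Fin n) → Finset (Fin n) → Fin n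
  pick_mem : ∀ past cur s, s.Nonempty → pick past cur s ∈ s

/-- The bins in `s` of least load among the bins in `s`. -/
def leastLoaded {n : ℕ} (load : Fin n → ℕ) (s : Finset (Fin n)) : Finset (Fin n) :=
  s.filter fun a => ∀ b ∈ s, load a ≤ load b

/-- The loop executed for one ball.  `load` holds the present bin loads, the first list argument
holds the bins already probed by this ball (most recent first), the second one the bins that the
remaining permitted probes would hit.  The result is the bin receiving the ball and the list of
all probes that were actually made.  (The bin is `none` only if no probe at all is permitted.) -/
def probeLoop {n : ℕ} (load : Fin n → ℕ) (pick : List (Fin n) → Finset (Fin n) → Fin n) :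
    List (Fin n) → List (Fin n) → Option (Fin n) × List (Fin n)
  | prev, [] => (prev.head?, prev)
  | prev, b :: rest =>
      if load b = 0 then
        (some b, b :: prev)
      else if ∃ a ∈ prev, load a ≠ load b then
        (some (pick (b :: prev) (leastLoaded load (b :: prev).toFinset)), b :: prev)
      else
        probeLoop load pick (b :: prev) rest

/-- The state of the allocation process: the load of each bin, and for every ball placed so far
(most recent ball first) the list of probes made for it. -/
structure State (n : ℕ) where
  load : Fin n → ℕ
  probes : List (List (Fin n))

/-- All bins are empty and no probe has been made. -/
def State.init (n : ℕ) : State n := ⟨fun _ => 0, []⟩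

/-- Place one ball, `p 0, p 1, …, p (k - 1)` being the bins its (at most `k`) probes would hit. -/
def placeBall {n k : ℕ} (tie : TieRule n) (s : State n) (p : Fin k → Fin n) : State n :=
  let r := probeLoop s.load (tie.pick s.probes) [] (List.ofFn p)
  ⟨fun b => s.load b + (if r.1 = some b then 1 else 0), r.2 :: s.probes⟩

/-- Place `m` balls one after the other into `n` initially empty bins with at most `k` probes per
ball; `ω t j` is the bin hit by the `j`-th probe of ball `t`, if that probe is made. -/
def run {m k n : ℕ} (tie : TieRule n) (ω : Fin m → Fin k → Fin n) : State n :=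
  (List.ofFn ω).foldl (placeBall tie) (State.init n)

/-- The total number of probes made in placing all the balls. -/
def totalProbes {m k n : ℕ} (tie : TieRule n) (ω : Fin m → Fin k → Fin n) : ℕ :=
  ((run tie ω).probes.map List.length).sum

/-- The maximum load of a bin after all the balls are placed. -/
def maxLoad {m k n : ℕ} (tie : TieRule n) (ω : Fin m → Fin k → Fin n) : ℕ :=
  Finset.univ.sup (run tie ω).load

/-- The law of the probes: all probes of all `m` balls are independent and uniform over the `n`
bins, that is, the uniform distribution on the finite set of all probe tables. -/
noncomputable def probeLaw (m k n : ℕ) : Measure (Fin m → Fin k → Fin n) :=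
  uniformOn Set.univ

/-- The smallest `N` such that `36 log m (72 e log m / (5 m)) ^ 4 ≤ 1 / m ^ 2` for all `m > N`,
with logarithms to base 2. -/
noncomputable def threshold : ℕ :=
  sInf {N : ℕ | ∀ m : ℕ, N < m →
    36 * Real.logb 2 m * (72 * Real.exp 1 * Real.logb 2 m / (5 * m)) ^ 4 ≤ 1 / (m : ℝ) ^ 2}

end FirstDiff

/-!
The proof compares each ball with simple chance experiments and works backwards over the balls:
a bound for the expectation over the remaining balls, valid for every state, is propagated
through one ball at a time (`expect_runFrom_le`).

*Number of probes.*  A ball continues past a probe only if the probed bin is nonempty, and when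
`r` balls remain the proportion of nonempty bins is at most `1 - r / n`.  So the expected number
of probes of that ball is at most `∑ j < k, (1 - r / n) ^ j`, and the sum over the balls is at
most `n` times the harmonic number of `k`, hence at most `n (1 + log k) ≤ 0.76 d n`, the logarithm
being natural.  This leaves room for two exponential-moment bounds.  Truncation at `k` probes,
with moment parameter `1 / (4 k)`, gives the tail bound `20 k / n`; ignoring the truncation, as in
the coupon collector's problem, gives `2 √n 2 ^ (- d / 2)`.  The first is used for
`k ≤ n ^ (4 / 5)`, the second for larger `k` (`totalProbes_tail`).

*Maximum load.*  Let `x` and `y` be the proportions of bins of load at least `i` and at least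
`i + 1`.  A ball goes into a bin of load at least `i` only if all its probes hit such bins; then
either all `k` probes do, or some probe hits a bin of load at least `i + 1` as well.  The
probability is at most `x ^ k + 3 x y` (`expect_destGE_le`).  The term `3 x y` is only a
self-reinforcement at rate `3 x` of the number of bins of load at least `i + 1`, which costs a
constant factor, so `x ≤ α` leads to `y ≤ 6 α ^ k` up to a small error with exponentially small
failure probability (`expect_exp_numGE_le`, `numGE_succ_tail`).  At most `n / 32` bins ever have
load `32` or more; iterating, the proportion at load `32 + j` is at most about `2 ^ (- k ^ j)`,
until after `J ≈ log_k (log n)` levels, the inner logarithm to base 2, it falls below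
`n ^ (- 1 / 4)` (`numGE_level_tail`).  As `k ≥ 7`, a union bound over the balls then shows that no
bin reaches the next level, except with probability `n ^ (1 - k / 4)`
(`expect_one_le_numGE_le`).  All bounds hold for large `n` irrespective of `d`, so the finitely
many small `n` only affect the constant.
-/

namespace FirstDiff

open scoped BigOperators

/-! ### Averages over finite probability spaces -/

theorem expect_fin_cons {m : ℕ} {β : Type*} [Fintype β] (f : (Fin (m + 1) → β) → ℝ) :
    𝔼 ω, f ω = 𝔼 b, 𝔼 ω' : Fin m → β, f (Fin.cons b ω') := by
  rw [← Fintype.expect_equiv (Fin.consEquiv fun _ : Fin (m + 1) => β)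
    (fun x => f (Fin.cons x.1 x.2)) f (fun x => rfl)]
  exact Finset.expect_product Finset.univ Finset.univ
    (fun x : β × (Fin m → β) => f (Fin.cons x.1 x.2))

theorem expect_mono {α : Type*} [Fintype α] {f g : α → ℝ} (h : ∀ a, f a ≤ g a) :
    𝔼 a, f a ≤ 𝔼 a, g a :=
  Finset.expect_le_expect fun a _ => h a

instance {m k n : ℕ} : IsFiniteMeasure (probeLaw m k n) := by
  unfold probeLaw uniformOn
  infer_instance

/-- The uniform law of the probes is an average over all probe tables. -/
theorem integral_probeLaw {m k n : ℕ} (f : (Fin m → Fin k → Fin n) → ℝ) :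
    ∫ ω, f ω ∂(probeLaw m k n) = 𝔼 ω, f ω := by
  have hsingle : ∀ ω : Fin m → Fin k → Fin n, (probeLaw m k n).real {ω}
      = (Fintype.card (Fin m → Fin k → Fin n) : ℝ)⁻¹ := by
    intro ω
    simp only [probeLaw, Measure.real, uniformOn_univ, Measure.count_singleton, one_div]
    simp
  rw [integral_fintype Integrable.of_finite, Fintype.expect_eq_sum_div_card, div_eq_inv_mul,
    Finset.mul_sum]
  simp only [hsingle, smul_eq_mul]

/-- Markov's inequality in the form used here: a set on which a nonnegative function is at
least one has probability at most the average of the function. -/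
theorem probeLaw_real_le_expect {m k n : ℕ} {S : Set (Fin m → Fin k → Fin n)}
    {f : (Fin m → Fin k → Fin n) → ℝ} (hf : ∀ ω, 0 ≤ f ω) (hS : ∀ ω ∈ S, 1 ≤ f ω) :
    (probeLaw m k n).real S ≤ 𝔼 ω, f ω := by
  rw [← integral_probeLaw, ← integral_indicator_one (Set.toFinite S).measurableSet]
  refine integral_mono Integrable.of_finite Integrable.of_finite fun ω => ?_
  by_cases h : ω ∈ S
  · simpa [h] using hS ω h
  · simpa [h] using hf ω

theorem probeLaw_real_le_one {m k n : ℕ} (S : Set (Fin m → Fin k → Fin n)) :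
    (probeLaw m k n).real S ≤ 1 := by
  refine (probeLaw_real_le_expect (f := fun _ => 1) (by simp) (by simp)).trans ?_
  rcases isEmpty_or_nonempty (Fin m → Fin k → Fin n) with h | h
  · simp [Finset.univ_eq_empty]
  · simp

/-! ### Load profiles -/

/-- The number of bins of load at least `i`. -/
def numGE {n : ℕ} (load : Fin n → ℕ) (i : ℕ) : ℕ :=
  (Finset.univ.filter fun b => i ≤ load b).card

/-- The proportion of bins of load at least `i`. -/
noncomputable def freq {n : ℕ} (load : Fin n → ℕ) (i : ℕ) : ℝ := (numGE load i : ℝ) / n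

theorem freq_nonneg {n : ℕ} (load : Fin n → ℕ) (i : ℕ) : 0 ≤ freq load i := by
  unfold freq; positivity

theorem expect_ite_le_load {n : ℕ} (load : Fin n → ℕ) (i : ℕ) :
    𝔼 b, (if i ≤ load b then (1 : ℝ) else 0) = freq load i := by
  rw [Fintype.expect_eq_sum_div_card, Finset.sum_boole]
  simp [freq, numGE]

theorem expect_le_freq {n : ℕ} [NeZero n] (load : Fin n → ℕ) {i : ℕ} {f : Fin n → ℝ} {u v : ℝ}
    (h : ∀ b, f b ≤ u + v * (if i ≤ load b then 1 else 0)) :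
    𝔼 b, f b ≤ u + v * freq load i := by
  refine (expect_mono h).trans_eq ?_
  rw [Finset.expect_add_distrib, ← Finset.mul_expect, expect_ite_le_load, Fintype.expect_const]

theorem expect_le_freq_add_freq {n : ℕ} (load : Fin n → ℕ) {i j : ℕ} {f : Fin n → ℝ} {u v : ℝ}
    (h : ∀ b, f b ≤ u * (if j ≤ load b then 1 else 0) + v * (if i ≤ load b then 1 else 0)) :
    𝔼 b, f b ≤ u * freq load j + v * freq load i := by
  refine (expect_mono h).trans_eq ?_
  rw [Finset.expect_add_distrib, ← Finset.mul_expect, ← Finset.mul_expect, expect_ite_le_load,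
    expect_ite_le_load]

theorem numGE_mul_le {n : ℕ} (load : Fin n → ℕ) (i : ℕ) : numGE load i * i ≤ ∑ b, load b := by
  calc numGE load i * i = ∑ b ∈ Finset.univ.filter (fun b => i ≤ load b), i := by
        simp [numGE]
    _ ≤ ∑ b ∈ Finset.univ.filter (fun b => i ≤ load b), load b :=
        Finset.sum_le_sum fun b hb => (Finset.mem_filter.1 hb).2
    _ ≤ ∑ b, load b := Finset.sum_le_sum_of_subset (Finset.filter_subset _ _)

/-! ### The number of probes of one ball -/

section OneBall

variable {n : ℕ} (load : Fin n → ℕ) (pick : List (Fin n) → Finset (Fin n) → Fin n)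

theorem suffix_probeLoop (prev rest : List (Fin n)) :
    prev <:+ (probeLoop load pick prev rest).2 := by
  induction rest generalizing prev with
  | nil => simp [probeLoop]
  | cons b rest ih =>
    rw [probeLoop]
    split_ifs
    · exact List.suffix_cons _ _
    · exact List.suffix_cons _ _
    · exact (List.suffix_cons _ _).trans (ih _)

theorem cons_suffix_probeLoop (prev : List (Fin n)) (b : Fin n) (rest : List (Fin n)) :
    (b :: prev) <:+ (probeLoop load pick prev (b :: rest)).2 := by
  rw [probeLoop]
  split_ifs
  · exact List.suffix_rfl
  · exact List.suffix_rfl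
  · exact suffix_probeLoop _ _ _ _

theorem length_probeLoop_le (prev rest : List (Fin n)) :
    (probeLoop load pick prev rest).2.length ≤ prev.length + rest.length := by
  induction rest generalizing prev with
  | nil => simp [probeLoop]
  | cons b rest ih =>
    rw [probeLoop]
    split_ifs
    · simp
    · simp
    · have := ih (b :: prev)
      simp only [List.length_cons] at this ⊢
      omega

theorem length_probeLoop_of_load_eq_zero (prev : List (Fin n)) {b : Fin n} (rest : List (Fin n))
    (hb : load b = 0) : (probeLoop load pick prev (b :: rest)).2.length = prev.length + 1 := by
  simp [probeLoop, hb]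

theorem length_probeLoop_cons_le (prev : List (Fin n)) (b : Fin n) (rest : List (Fin n)) :
    (probeLoop load pick prev (b :: rest)).2.length
      ≤ (probeLoop load pick (b :: prev) rest).2.length := by
  have := (suffix_probeLoop load pick (b :: prev) rest).length_le
  rw [probeLoop.eq_def load pick prev (b :: rest)]
  dsimp only
  split_ifs
  · exact this
  · exact this
  · exact le_rfl

/-- A ball continues past a probe only if the probed bin is not empty, so its expected number of
probes is at most a truncated geometric series in the proportion of nonempty bins. -/
theorem expect_length_probeLoop_le [NeZero n] (k : ℕ) (prev : List (Fin n)) :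
    𝔼 p : Fin k → Fin n, ((probeLoop load pick prev (List.ofFn p)).2.length : ℝ)
      ≤ prev.length + ∑ j ∈ Finset.range k, freq load 1 ^ j := by
  induction k generalizing prev with
  | zero => simp [probeLoop]
  | succ k ih =>
    rw [expect_fin_cons]
    set S : ℝ := ∑ j ∈ Finset.range k, freq load 1 ^ j with hS
    have hS0 : 0 ≤ S := Finset.sum_nonneg fun j _ => pow_nonneg (freq_nonneg _ _) _
    have : ∀ b : Fin n, 𝔼 p : Fin k → Fin n, ((probeLoop load pick prev
        (List.ofFn (Fin.cons b p : Fin (k + 1) → Fin n))).2.length : ℝ)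
        ≤ (prev.length + 1) + S * (if 1 ≤ load b then 1 else 0) := by
      intro b
      simp only [List.ofFn_succ, Fin.cons_zero, Fin.cons_succ]
      by_cases hb : load b = 0
      · simp [length_probeLoop_of_load_eq_zero, hb]
      · have h1 : 1 ≤ load b := by omega
        simp only [h1, if_true, mul_one]
        calc _ ≤ 𝔼 p : Fin k → Fin n,
              ((probeLoop load pick (b :: prev) (List.ofFn p)).2.length : ℝ) :=
              expect_mono fun p => by exact_mod_cast length_probeLoop_cons_le load pick prev b _
          _ ≤ _ := by simpa using ih (b :: prev)
    refine (expect_le_freq load this).trans_eq ?_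
    rw [Finset.sum_range_succ', hS, Finset.sum_mul]
    simp only [pow_succ, pow_zero]
    ring

/-- A supersolution `g` of the recursion for the moment generating function of the number of
probes bounds it. -/
theorem expect_pow_length_probeLoop_le [NeZero n] {w g : ℝ} (hw : 1 ≤ w) (hg : 1 ≤ g)
    (h : w * (1 + (g - 1) * freq load 1) ≤ g) (k : ℕ) (prev : List (Fin n)) :
    𝔼 p : Fin k → Fin n, w ^ (probeLoop load pick prev (List.ofFn p)).2.length
      ≤ w ^ prev.length * g := by
  have hw0 : 0 ≤ w := by linarith
  induction k generalizing prev with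
  | zero => simpa [probeLoop] using le_mul_of_one_le_right (pow_nonneg hw0 _) hg
  | succ k ih =>
    rw [expect_fin_cons]
    have : ∀ b : Fin n, 𝔼 p : Fin k → Fin n, w ^ (probeLoop load pick prev
        (List.ofFn (Fin.cons b p : Fin (k + 1) → Fin n))).2.length
        ≤ w ^ (prev.length + 1)
          + (w ^ (prev.length + 1) * (g - 1)) * (if 1 ≤ load b then 1 else 0) := by
      intro b
      simp only [List.ofFn_succ, Fin.cons_zero, Fin.cons_succ]
      by_cases hb : load b = 0
      · simp [length_probeLoop_of_load_eq_zero, hb]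
      · have h1 : 1 ≤ load b := by omega
        simp only [h1, if_true, mul_one]
        calc _ ≤ 𝔼 p : Fin k → Fin n,
              w ^ (probeLoop load pick (b :: prev) (List.ofFn p)).2.length :=
              expect_mono fun p =>
                pow_le_pow_right₀ hw (length_probeLoop_cons_le load pick prev b _)
          _ ≤ w ^ (b :: prev).length * g := ih (b :: prev)
          _ = _ := by rw [List.length_cons]; ring
    refine (expect_le_freq load this).trans ?_
    calc _ = w ^ prev.length * (w * (1 + (g - 1) * freq load 1)) := by ring
      _ ≤ _ := mul_le_mul_of_nonneg_left h (pow_nonneg hw0 _)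

/-! ### The destination of one ball -/

/-- The bin receiving the ball has the least load among the probed bins. -/
theorem load_probeLoop_le (hpick : ∀ cur s, s.Nonempty → pick cur s ∈ s)
    (prev rest : List (Fin n)) (hprev : ∀ a ∈ prev, ∀ a' ∈ prev, load a = load a') {c : Fin n}
    (hc : (probeLoop load pick prev rest).1 = some c) :
    ∀ a ∈ (probeLoop load pick prev rest).2, load c ≤ load a := by
  induction rest generalizing prev with
  | nil =>
    simp only [probeLoop] at hc ⊢
    exact fun a ha => (hprev c (List.mem_of_head? hc) a ha).le
  | cons b rest ih =>
    rw [probeLoop] at hc ⊢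
    split_ifs at hc ⊢ with h0 hd
    · simp only [Option.some.injEq] at hc
      subst hc
      simp [h0]
    · simp only [Option.some.injEq] at hc
      have hne : (leastLoaded load (b :: prev).toFinset).Nonempty := by
        obtain ⟨x, hx, hmin⟩ := Finset.exists_min_image (b :: prev).toFinset load
          ⟨b, by simp⟩
        exact ⟨x, Finset.mem_filter.2 ⟨hx, hmin⟩⟩
      have hm := hpick (b :: prev) _ hne
      rw [hc] at hm
      exact fun a ha => (Finset.mem_filter.1 hm).2 a (List.mem_toFinset.2 ha)
    · push Not at hd
      refine ih (b :: prev) ?_ hc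
      intro a ha a' ha'
      rw [List.mem_cons] at ha ha'
      rcases ha with rfl | ha <;> rcases ha' with rfl | ha'
      · rfl
      · exact (hd a' ha').symm
      · exact hd a ha
      · exact hprev a ha a' ha'

/-- The indicator of the event that the ball goes into a bin of load at least `i`. -/
def destGE (i : ℕ) (o : Option (Fin n)) : ℝ :=
  if ∃ c, o = some c ∧ i ≤ load c then 1 else 0

theorem destGE_nonneg (i : ℕ) (o : Option (Fin n)) : 0 ≤ destGE load i o := by
  unfold destGE; split_ifs <;> norm_num

theorem destGE_le_one (i : ℕ) (o : Option (Fin n)) : destGE load i o ≤ 1 := by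
  unfold destGE; split_ifs <;> norm_num

variable {load pick} in
theorem destGE_probeLoop_eq_zero (hpick : ∀ cur s, s.Nonempty → pick cur s ∈ s)
    {prev : List (Fin n)} (hprev : ∀ a ∈ prev, ∀ a' ∈ prev, load a = load a') {i : ℕ} {b : Fin n}
    (hb : load b < i) (rest : List (Fin n)) :
    destGE load i (probeLoop load pick prev (b :: rest)).1 = 0 := by
  refine if_neg ?_
  rintro ⟨c, hc, hi⟩
  have := load_probeLoop_le load pick hpick prev _ hprev hc b
    ((cons_suffix_probeLoop load pick prev b rest).subset (by simp))
  omega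

theorem expect_destGE_le_one {k i : ℕ} (F : (Fin k → Fin n) → Option (Fin n)) [NeZero n] :
    𝔼 p, destGE load i (F p) ≤ 1 := by
  refine (expect_mono fun p => destGE_le_one load i _).trans_eq ?_
  simp

variable {load pick} in
/-- The bound for a ball all of whose previous probes hit bins of load exactly `i`: it goes into a
bin of load at least `i` only by exhausting its `k` remaining probes on such bins or by hitting a
bin of load at least `i + 1` after some of them. -/
theorem expect_destGE_of_load_eq [NeZero n] (hpick : ∀ cur s, s.Nonempty → pick cur s ∈ s)
    {i : ℕ} (hi : 1 ≤ i) (k : ℕ) (prev : List (Fin n)) (hprev : ∀ a ∈ prev, load a = i) :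
    𝔼 p : Fin k → Fin n, destGE load i (probeLoop load pick prev (List.ofFn p)).1
      ≤ freq load i ^ k + freq load (i + 1) * ∑ j ∈ Finset.range k, freq load i ^ j := by
  induction k generalizing prev with
  | zero => simpa using destGE_le_one load i _
  | succ k ih =>
    rw [expect_fin_cons]
    set R : ℝ := freq load i ^ k + freq load (i + 1) * ∑ j ∈ Finset.range k, freq load i ^ j
      with hR
    have hR0 : 0 ≤ R := add_nonneg (pow_nonneg (freq_nonneg _ _) _) (mul_nonneg (freq_nonneg _ _)
      (Finset.sum_nonneg fun j _ => pow_nonneg (freq_nonneg _ _) _))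
    have hhom : ∀ a ∈ prev, ∀ a' ∈ prev, load a = load a' := fun a ha a' ha' => by
      rw [hprev a ha, hprev a' ha']
    have : ∀ b : Fin n, 𝔼 p : Fin k → Fin n, destGE load i (probeLoop load pick prev
        (List.ofFn (Fin.cons b p : Fin (k + 1) → Fin n))).1
        ≤ 1 * (if i + 1 ≤ load b then 1 else 0) + R * (if i ≤ load b then 1 else 0) := by
      intro b
      simp only [List.ofFn_succ, Fin.cons_zero, Fin.cons_succ]
      rcases lt_trichotomy (load b) i with hb | hb | hb
      · simp only [destGE_probeLoop_eq_zero hpick hhom hb]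
        simp [hb.not_ge, show ¬ (i + 1 ≤ load b) by omega]
      · have hstep : ∀ rest, probeLoop load pick prev (b :: rest)
            = probeLoop load pick (b :: prev) rest := by
          intro rest
          rw [probeLoop.eq_def]
          dsimp only
          rw [if_neg (by omega), if_neg]
          rintro ⟨a, ha, hne⟩
          exact hne ((hprev a ha).trans hb.symm)
        simp only [hstep]
        refine (ih (b :: prev) ?_).trans_eq ?_
        · simpa [hb] using hprev
        · simp [hb]
      · refine (expect_destGE_le_one load _).trans ?_
        simp [hb.le, show i + 1 ≤ load b by omega, hR0]
    refine (expect_le_freq_add_freq load this).trans_eq ?_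
    rw [Finset.sum_range_succ', hR, add_mul, mul_assoc _ (Finset.sum _ _), Finset.sum_mul]
    simp only [pow_succ, pow_zero]
    ring

theorem sum_pow_le_two {x : ℝ} (h0 : 0 ≤ x) (h : x ≤ 1 / 2) (k : ℕ) :
    ∑ j ∈ Finset.range k, x ^ j ≤ 2 := by
  have h1 := geom_sum_mul_neg x k
  have h2 : 0 ≤ x ^ k := pow_nonneg h0 k
  have h3 : 0 ≤ ∑ j ∈ Finset.range k, x ^ j := Finset.sum_nonneg fun j _ => pow_nonneg h0 j
  nlinarith

variable {load pick} in
/-- A ball goes into a bin of load at least `i` only if all its probes hit bins of load at least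
`i`.  Either it makes all `k` probes, or it also hits a bin of load at least `i + 1`. -/
theorem expect_destGE_le [NeZero n] (hpick : ∀ cur s, s.Nonempty → pick cur s ∈ s)
    {i k : ℕ} (hi : 1 ≤ i) (hk : 2 ≤ k) (hx : freq load i ≤ 1 / 2) :
    𝔼 p : Fin k → Fin n, destGE load i (probeLoop load pick [] (List.ofFn p)).1
      ≤ freq load i ^ k + 3 * freq load i * freq load (i + 1) := by
  obtain ⟨k, rfl⟩ := Nat.exists_eq_add_of_le' hk
  rw [expect_fin_cons]
  set R : ℝ := freq load i ^ (k + 1)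
    + freq load (i + 1) * ∑ j ∈ Finset.range (k + 1), freq load i ^ j with hR
  have hR0 : 0 ≤ R := add_nonneg (pow_nonneg (freq_nonneg _ _) _) (mul_nonneg (freq_nonneg _ _)
    (Finset.sum_nonneg fun j _ => pow_nonneg (freq_nonneg _ _) _))
  have : ∀ b : Fin n, 𝔼 p : Fin (k + 1) → Fin n, destGE load i (probeLoop load pick []
      (List.ofFn (Fin.cons b p : Fin (k + 1 + 1) → Fin n))).1
      ≤ freq load i * (if i + 1 ≤ load b then 1 else 0) + R * (if i ≤ load b then 1 else 0) := by
    intro b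
    rw [show (𝔼 p : Fin (k + 1) → Fin n, destGE load i (probeLoop load pick []
        (List.ofFn (Fin.cons b p : Fin (k + 1 + 1) → Fin n))).1)
        = 𝔼 p : Fin (k + 1) → Fin n, destGE load i (probeLoop load pick []
        (b :: List.ofFn p)).1 by
      simp only [List.ofFn_succ, Fin.cons_zero, Fin.cons_succ]]
    rcases lt_or_ge (load b) i with hb | hb
    · simp only [destGE_probeLoop_eq_zero hpick (prev := []) (by simp) hb]
      simp [hb.not_ge, show ¬ (i + 1 ≤ load b) by omega]
    have hstep : ∀ rest, probeLoop load pick [] (b :: rest) = probeLoop load pick [b] rest := by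
      intro rest
      rw [probeLoop.eq_def]
      dsimp only
      rw [if_neg (by omega), if_neg (by simp)]
    simp only [hstep]
    rcases hb.eq_or_lt with hb | hb
    · refine (expect_destGE_of_load_eq hpick hi (k + 1) [b] (by simp [hb])).trans_eq ?_
      simp [hR, ← hb]
    · rw [expect_fin_cons]
      have h2 : ∀ b' : Fin n, 𝔼 p : Fin k → Fin n, destGE load i (probeLoop load pick [b]
          (List.ofFn (Fin.cons b' p : Fin (k + 1) → Fin n))).1
          ≤ 0 + 1 * (if i ≤ load b' then 1 else 0) := by
        intro b'
        simp only [List.ofFn_succ, Fin.cons_zero, Fin.cons_succ]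
        by_cases hb' : i ≤ load b'
        · simpa [hb'] using expect_destGE_le_one load (i := i) (k := k) _
        · simp only [destGE_probeLoop_eq_zero hpick (prev := [b]) (by simp) (not_le.1 hb')]
          simp [hb']
      refine (expect_le_freq load h2).trans ?_
      simp [hb.le, show i + 1 ≤ load b by omega, hR0]
  refine (expect_le_freq_add_freq load this).trans ?_
  have hs := sum_pow_le_two (freq_nonneg load i) hx (k + 1)
  have hxy := mul_nonneg (freq_nonneg load i) (freq_nonneg load (i + 1))
  have := mul_le_mul_of_nonneg_left hs hxy
  rw [hR, pow_succ (freq load i) (k + 1)]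
  nlinarith

end OneBall

/-! ### The process started from an arbitrary state -/

section Evolution

variable {n k : ℕ} (tie : TieRule n)

/-- The state reached from `s` after placing `m` further balls. -/
def runFrom {m : ℕ} (s : State n) (ω : Fin m → Fin k → Fin n) : State n :=
  (List.ofFn ω).foldl (placeBall tie) s

theorem runFrom_zero (s : State n) (ω : Fin 0 → Fin k → Fin n) : runFrom tie s ω = s := by
  simp [runFrom]

theorem runFrom_cons {m : ℕ} (s : State n) (p : Fin k → Fin n) (ω : Fin m → Fin k → Fin n) :
    runFrom tie s (Fin.cons p ω : Fin (m + 1) → Fin k → Fin n)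
      = runFrom tie (placeBall tie s p) ω := by
  simp [runFrom, List.ofFn_succ]

/-- Backward induction over the balls: `B m s` bounds the expected value of `Φ` after `m` further
balls, when `B m` bounds the expectation over one ball for every state satisfying the
invariant `I m`. -/
theorem expect_runFrom_le [NeZero n] {Φ : State n → ℝ} {B : ℕ → State n → ℝ}
    {I : ℕ → State n → Prop} (h0 : ∀ s, I 0 s → Φ s ≤ B 0 s)
    (hI : ∀ m s, I (m + 1) s → ∀ p : Fin k → Fin n, I m (placeBall tie s p))
    (hB : ∀ m s, I (m + 1) s → 𝔼 p : Fin k → Fin n, B m (placeBall tie s p) ≤ B (m + 1) s)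
    (m : ℕ) (s : State n) (hs : I m s) :
    𝔼 ω : Fin m → Fin k → Fin n, Φ (runFrom tie s ω) ≤ B m s := by
  induction m generalizing s with
  | zero => simpa [runFrom_zero] using h0 s hs
  | succ m ih =>
    rw [expect_fin_cons]
    simp only [runFrom_cons]
    exact (expect_mono fun p => ih _ (hI m s hs p)).trans (hB m s hs)

/-- The number of probes made so far. -/
def State.total (s : State n) : ℕ := (s.probes.map List.length).sum

theorem total_placeBall (s : State n) (p : Fin k → Fin n) :
    (placeBall tie s p).total = s.total
      + (probeLoop s.load (tie.pick s.probes) [] (List.ofFn p)).2.length := by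
  simp [State.total, placeBall, add_comm]

theorem load_le_load_placeBall (s : State n) (p : Fin k → Fin n) (b : Fin n) :
    s.load b ≤ (placeBall tie s p).load b := by
  simp [placeBall]

theorem sum_load_placeBall_le (s : State n) (p : Fin k → Fin n) :
    ∑ b, (placeBall tie s p).load b ≤ ∑ b, s.load b + 1 := by
  simp only [placeBall, Finset.sum_add_distrib]
  rcases (probeLoop s.load (tie.pick s.probes) [] (List.ofFn p)).1 with _ | c <;> simp

theorem sum_load_runFrom_le {m : ℕ} (s : State n) (ω : Fin m → Fin k → Fin n) :
    ∑ b, (runFrom tie s ω).load b ≤ ∑ b, s.load b + m := by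
  induction m generalizing s with
  | zero => simp [runFrom_zero]
  | succ m ih =>
    rw [← Fin.cons_self_tail ω, runFrom_cons]
    have h1 := ih (placeBall tie s (ω 0)) (Fin.tail ω)
    have h2 := sum_load_placeBall_le tie s (ω 0)
    omega

theorem numGE_le_numGE_placeBall (s : State n) (p : Fin k → Fin n) (i : ℕ) :
    numGE s.load i ≤ numGE (placeBall tie s p).load i :=
  Finset.card_le_card (Finset.monotone_filter_right _
    fun b _ hb => hb.trans (load_le_load_placeBall tie s p b))

/-- A new bin of load at least `i + 1` arises only from a ball going into a bin of load
at least `i`. -/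
theorem numGE_placeBall_le (s : State n) (p : Fin k → Fin n) (i : ℕ) :
    (numGE (placeBall tie s p).load (i + 1) : ℝ) ≤ numGE s.load (i + 1)
      + destGE s.load i (probeLoop s.load (tie.pick s.probes) [] (List.ofFn p)).1 := by
  set o := (probeLoop s.load (tie.pick s.probes) [] (List.ofFn p)).1 with ho
  have hload : ∀ b, (placeBall tie s p).load b = s.load b + if o = some b then 1 else 0 :=
    fun b => rfl
  unfold destGE
  split_ifs with h
  · obtain ⟨c, hc, -⟩ := h
    have : (Finset.univ.filter fun b => i + 1 ≤ (placeBall tie s p).load b)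
        ⊆ insert c (Finset.univ.filter fun b => i + 1 ≤ s.load b) := by
      intro b hb
      simp only [Finset.mem_filter, Finset.mem_univ, true_and, hload, hc, Option.some.injEq,
        Finset.mem_insert] at hb ⊢
      by_cases hcb : c = b
      · exact Or.inl hcb.symm
      · right; simpa [hcb] using hb
    exact_mod_cast (Finset.card_le_card this).trans (Finset.card_insert_le _ _)
  · have : (Finset.univ.filter fun b => i + 1 ≤ (placeBall tie s p).load b)
        ⊆ Finset.univ.filter fun b => i + 1 ≤ s.load b := by
      intro b hb
      simp only [Finset.mem_filter, Finset.mem_univ, true_and, hload] at hb ⊢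
      by_cases hcb : o = some b
      · rw [if_pos hcb] at hb
        exact absurd ⟨b, hcb, by omega⟩ h
      · simpa [hcb] using hb
    rw [add_zero]
    exact_mod_cast Finset.card_le_card this

theorem numGE_one_placeBall_le (s : State n) (p : Fin k → Fin n) :
    numGE (placeBall tie s p).load 1 ≤ numGE s.load 1 + 1 := by
  have := (numGE_placeBall_le tie s p 0).trans (add_le_add_right (destGE_le_one _ _ _) _)
  exact_mod_cast this

end Evolution

/-! ### Moments of the total number of probes -/

section Total

variable {n k : ℕ} (tie : TieRule n)

/-- When `m` balls remain, at least `m` bins are empty. -/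
theorem freq_one_le [NeZero n] {load : Fin n → ℕ} {m : ℕ} (h : numGE load 1 + m ≤ n) :
    freq load 1 ≤ ((n - m : ℕ) : ℝ) / n := by
  unfold freq
  gcongr
  omega

theorem expect_total_le [NeZero n] (m : ℕ) (s : State n) (hs : numGE s.load 1 + m ≤ n) :
    𝔼 ω : Fin m → Fin k → Fin n, ((runFrom tie s ω).total : ℝ) ≤ s.total
      + ∑ r ∈ Finset.range m, ∑ j ∈ Finset.range k, (((n - (r + 1) : ℕ) : ℝ) / n) ^ j := by
  refine expect_runFrom_le tie (Φ := fun s => (s.total : ℝ)) (B := fun m s => (s.total : ℝ)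
      + ∑ r ∈ Finset.range m, ∑ j ∈ Finset.range k, (((n - (r + 1) : ℕ) : ℝ) / n) ^ j)
    (I := fun m s => numGE s.load 1 + m ≤ n) (by simp) ?_ ?_ m s hs
  · intro m s h p
    have := numGE_one_placeBall_le tie s p
    omega
  · intro m s h
    simp only [total_placeBall, Nat.cast_add]
    rw [Finset.expect_add_distrib, Finset.expect_add_distrib, Fintype.expect_const,
      Fintype.expect_const, Finset.sum_range_succ]
    have h1 := expect_length_probeLoop_le s.load (tie.pick s.probes) k []
    have h2 : ∑ j ∈ Finset.range k, freq s.load 1 ^ j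
        ≤ ∑ j ∈ Finset.range k, (((n - (m + 1) : ℕ) : ℝ) / n) ^ j :=
      Finset.sum_le_sum fun j _ => pow_le_pow_left₀ (freq_nonneg _ _) (freq_one_le h) j
    simp only [List.length_nil, Nat.cast_zero, zero_add] at h1
    linarith

theorem expect_pow_total_le [NeZero n] {w : ℝ} (hw : 1 ≤ w) {c : ℕ → ℝ} (hc0 : ∀ r, 0 ≤ c r)
    (hc : ∀ (load : Fin n → ℕ) pick r, numGE load 1 + (r + 1) ≤ n →
      𝔼 p : Fin k → Fin n, w ^ (probeLoop load pick [] (List.ofFn p)).2.length ≤ c r)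
    (m : ℕ) (s : State n) (hs : numGE s.load 1 + m ≤ n) :
    𝔼 ω : Fin m → Fin k → Fin n, w ^ (runFrom tie s ω).total
      ≤ w ^ s.total * ∏ r ∈ Finset.range m, c r := by
  refine expect_runFrom_le tie (Φ := fun s => w ^ s.total) (B := fun m s => w ^ s.total
      * ∏ r ∈ Finset.range m, c r)
    (I := fun m s => numGE s.load 1 + m ≤ n) (by simp) ?_ ?_ m s hs
  · intro m s h p
    have := numGE_one_placeBall_le tie s p
    omega
  · intro m s h
    simp only [total_placeBall, pow_add]
    rw [← Finset.expect_mul, ← Finset.mul_expect, Finset.prod_range_succ, mul_assoc]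
    refine mul_le_mul_of_nonneg_left ?_ (by positivity)
    rw [mul_comm]
    exact mul_le_mul_of_nonneg_left (hc s.load (tie.pick s.probes) m h)
      (Finset.prod_nonneg fun r _ => hc0 r)

end Total

/-! ### The growth of the number of highly loaded bins -/

section Levels

variable {n k : ℕ} (tie : TieRule n)

theorem freq_le_of_numGE_le [NeZero n] {load : Fin n → ℕ} {i : ℕ} {α : ℝ}
    (h : (numGE load i : ℝ) ≤ α * n) : freq load i ≤ α := by
  unfold freq
  rwa [div_le_iff₀ (by exact_mod_cast NeZero.pos n)]

theorem expect_destGE_placeBall_le [NeZero n] (s : State n) {i : ℕ} (hi : 1 ≤ i) (hk : 2 ≤ k)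
    {α : ℝ} (hα : α ≤ 1 / 2) (h : (numGE s.load i : ℝ) ≤ α * n) :
    𝔼 p : Fin k → Fin n,
        destGE s.load i (probeLoop s.load (tie.pick s.probes) [] (List.ofFn p)).1
      ≤ α ^ k + 3 * α * (numGE s.load (i + 1) / n) := by
  have hx := freq_le_of_numGE_le h
  refine (expect_destGE_le (tie.pick_mem s.probes) hi hk (hx.trans hα)).trans ?_
  have h0 := freq_nonneg s.load i
  have h1 := freq_nonneg s.load (i + 1)
  have : freq s.load (i + 1) = numGE s.load (i + 1) / n := rfl
  rw [← this]
  gcongr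

theorem numGE_placeBall_gt (s : State n) (p : Fin k → Fin n) {i : ℕ} {u : ℝ}
    (h : ¬ (numGE s.load i : ℝ) ≤ u) : ¬ (numGE (placeBall tie s p).load i : ℝ) ≤ u := fun h' =>
  h (le_trans (by exact_mod_cast numGE_le_numGE_placeBall tie s p i) h')

theorem exp_sub_one_le {x : ℝ} (h0 : 0 ≤ x) (h1 : x ≤ 1) : Real.exp x - 1 ≤ 2 * x := by
  have := abs_le.1 (Real.abs_exp_sub_one_sub_id_le (abs_le.2 ⟨by linarith, h1⟩))
  nlinarith [this.2]

/-- As long as at most `α n` bins have load at least `i`, the number `N` of bins of load at least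
`i + 1` grows with probability at most `α ^ k + 3 α N / n` per ball.  The reinforcement by `N`
costs only a constant factor in the exponent, absorbed by the factors `(1 + 6 α / n) ^ m`. -/
theorem expect_exp_numGE_le [NeZero n] {i : ℕ} (hi : 1 ≤ i) (hk : 2 ≤ k) {α : ℝ} (hα0 : 0 ≤ α)
    (hα : α ≤ 1 / 6) (m : ℕ) (hm : m ≤ n) (s : State n) :
    𝔼 ω : Fin m → Fin k → Fin n, (if (numGE (runFrom tie s ω).load i : ℝ) ≤ α * n then
        Real.exp (numGE (runFrom tie s ω).load (i + 1) / 3) else 0)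
      ≤ if (numGE s.load i : ℝ) ≤ α * n then
          Real.exp ((1 + 6 * α / n) ^ m / 3 * numGE s.load (i + 1) + 2 * α ^ k * m) else 0 := by
  have hn : (0 : ℝ) < n := by exact_mod_cast NeZero.pos n
  refine expect_runFrom_le tie
    (Φ := fun s => if (numGE s.load i : ℝ) ≤ α * n then
      Real.exp (numGE s.load (i + 1) / 3) else 0)
    (B := fun m s => if (numGE s.load i : ℝ) ≤ α * n then
      Real.exp ((1 + 6 * α / n) ^ m / 3 * numGE s.load (i + 1) + 2 * α ^ k * m) else 0)
    (I := fun m _ => m ≤ n) ?_ ?_ ?_ m s hm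
  · intro s _
    simp [div_eq_inv_mul]
  · intro m s h p
    omega
  · intro m s h
    by_cases hs : (numGE s.load i : ℝ) ≤ α * n
    swap
    · simp [hs, numGE_placeBall_gt tie s _ hs]
    set θ : ℝ := (1 + 6 * α / n) ^ m / 3 with hθ
    have hθ0 : 0 ≤ θ := by positivity
    have hθ1 : θ ≤ 1 := by
      have h1 : (1 + 6 * α / n) ^ m ≤ Real.exp 1 := by
        calc (1 + 6 * α / n) ^ m ≤ (Real.exp (6 * α / n)) ^ m := by
              gcongr
              linarith [Real.add_one_le_exp (6 * α / n)]
          _ = Real.exp (m * (6 * α / n)) := by rw [Real.exp_nat_mul]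
          _ ≤ Real.exp 1 := by
              refine Real.exp_le_exp.2 ?_
              have hmn : (m : ℝ) ≤ n := by exact_mod_cast (by omega : m ≤ n)
              calc (m : ℝ) * (6 * α / n) ≤ n * (6 * α / n) := by gcongr
                _ = 6 * α := by field_simp
                _ ≤ 1 := by linarith
      have := Real.exp_one_lt_d9
      rw [hθ]
      linarith
    set N := (numGE s.load (i + 1) : ℝ) with hN
    have hN0 : 0 ≤ N := by positivity
    have hpoint : ∀ p : Fin k → Fin n,
        (if (numGE (placeBall tie s p).load i : ℝ) ≤ α * n then
          Real.exp (θ * numGE (placeBall tie s p).load (i + 1) + 2 * α ^ k * m) else 0)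
        ≤ Real.exp (θ * N + 2 * α ^ k * m) + Real.exp (θ * N + 2 * α ^ k * m) * (2 * θ)
          * destGE s.load i (probeLoop s.load (tie.pick s.probes) [] (List.ofFn p)).1 := by
      intro p
      set D := destGE s.load i (probeLoop s.load (tie.pick s.probes) [] (List.ofFn p)).1 with hD
      have hD01 : D = 0 ∨ D = 1 := by
        rw [hD]; unfold destGE; split_ifs <;> simp
      have hle := numGE_placeBall_le tie s p i
      rw [← hD, ← hN] at hle
      have hexp : Real.exp (θ * numGE (placeBall tie s p).load (i + 1) + 2 * α ^ k * m)
          ≤ Real.exp (θ * N + 2 * α ^ k * m) * (1 + 2 * θ * D) := by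
        calc _ ≤ Real.exp (θ * (N + D) + 2 * α ^ k * m) := by gcongr
          _ = Real.exp (θ * N + 2 * α ^ k * m) * Real.exp (θ * D) := by
              rw [← Real.exp_add]; ring_nf
          _ ≤ _ := by
              gcongr
              rcases hD01 with h | h <;> rw [h]
              · simp
              · have := exp_sub_one_le hθ0 hθ1
                simp only [mul_one]
                linarith
      split_ifs
      · exact hexp.trans_eq (by ring)
      · have := destGE_nonneg s.load i
          (probeLoop s.load (tie.pick s.probes) [] (List.ofFn p)).1
        positivity
    refine (expect_mono hpoint).trans ?_
    rw [if_pos hs, Finset.expect_add_distrib, Fintype.expect_const, ← Finset.mul_expect]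
    have hP := expect_destGE_placeBall_le tie s hi hk (by linarith) hs
    rw [← hN] at hP
    set P := 𝔼 p : Fin k → Fin n,
        destGE s.load i (probeLoop s.load (tie.pick s.probes) [] (List.ofFn p)).1
    calc _ = Real.exp (θ * N + 2 * α ^ k * m) * (2 * θ * P + 1) := by ring
      _ ≤ Real.exp (θ * N + 2 * α ^ k * m) * Real.exp (2 * θ * P) := by
          gcongr
          exact Real.add_one_le_exp _
      _ = Real.exp (θ * N + 2 * α ^ k * m + 2 * θ * P) := by rw [← Real.exp_add]
      _ ≤ _ := by
          refine Real.exp_le_exp.2 ?_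
          have h1 : 2 * θ * P ≤ 2 * θ * (α ^ k + 3 * α * (N / n)) := by gcongr
          have h2 : 2 * θ * α ^ k ≤ 2 * 1 * α ^ k := by gcongr
          have h3 : (1 + 6 * α / n) ^ (m + 1) / 3 * N = θ * N + 2 * θ * (3 * α * (N / n)) := by
            rw [hθ, pow_succ]; field_simp; ring
          rw [h3]
          push_cast
          linarith

/-- As long as at most `α n` bins have load at least `i`, the first bin of load `i + 1` arises
with probability at most `α ^ k` per ball. -/
theorem expect_one_le_numGE_le [NeZero n] {i : ℕ} (hi : 1 ≤ i) (hk : 2 ≤ k) {α : ℝ} (hα0 : 0 ≤ α)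
    (hα : α ≤ 1 / 2) (m : ℕ) (s : State n) :
    𝔼 ω : Fin m → Fin k → Fin n, (if (numGE (runFrom tie s ω).load i : ℝ) ≤ α * n ∧
        1 ≤ numGE (runFrom tie s ω).load (i + 1) then (1 : ℝ) else 0)
      ≤ (if 1 ≤ numGE s.load (i + 1) then 1 else 0) + α ^ k * m := by
  have hαk : 0 ≤ α ^ k := by positivity
  have key := expect_runFrom_le (k := k) tie
    (Φ := fun s => if (numGE s.load i : ℝ) ≤ α * n ∧ 1 ≤ numGE s.load (i + 1) then (1 : ℝ) else 0)
    (B := fun m s => if (numGE s.load i : ℝ) ≤ α * n then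
      (if 1 ≤ numGE s.load (i + 1) then 1 else 0) + α ^ k * m else 0)
    (I := fun _ _ => True) ?_ (by simp) ?_ m s trivial
  · refine key.trans ?_
    by_cases hs : (numGE s.load i : ℝ) ≤ α * n
    · rw [if_pos hs]
    · rw [if_neg hs]
      positivity
  · intro s _
    by_cases h : (numGE s.load i : ℝ) ≤ α * n <;> simp [h]
  · intro m s _
    by_cases hs : (numGE s.load i : ℝ) ≤ α * n
    swap
    · simp [hs, numGE_placeBall_gt tie s _ hs]
    rw [if_pos hs]
    by_cases hN : 1 ≤ numGE s.load (i + 1)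
    · rw [if_pos hN]
      refine (expect_mono (g := fun _ => 1 + α ^ k * m) fun p => ?_).trans ?_
      · split_ifs
        · exact le_rfl
        · linarith
        · positivity
      · rw [Fintype.expect_const]
        push_cast
        linarith
    · rw [if_neg hN]
      have hN0 : numGE s.load (i + 1) = 0 := by omega
      have hpoint : ∀ p : Fin k → Fin n,
          (if (numGE (placeBall tie s p).load i : ℝ) ≤ α * n then
            (if 1 ≤ numGE (placeBall tie s p).load (i + 1) then (1 : ℝ) else 0) + α ^ k * m else 0)
          ≤ destGE s.load i (probeLoop s.load (tie.pick s.probes) [] (List.ofFn p)).1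
            + α ^ k * m := by
        intro p
        have hle := numGE_placeBall_le tie s p i
        rw [hN0, Nat.cast_zero, zero_add] at hle
        have hD := destGE_nonneg s.load i
          (probeLoop s.load (tie.pick s.probes) [] (List.ofFn p)).1
        split_ifs with h1 h2
        · have : (1 : ℝ) ≤ numGE (placeBall tie s p).load (i + 1) := by exact_mod_cast h2
          linarith
        · linarith
        · positivity
      refine (expect_mono hpoint).trans ?_
      rw [Finset.expect_add_distrib, Fintype.expect_const]
      have hP := expect_destGE_placeBall_le tie s hi hk hα hs
      rw [hN0] at hP
      push_cast
      simp only [Nat.cast_zero, zero_div, mul_zero, add_zero] at hP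
      linarith

end Levels

/-! ### Numerical estimates -/

theorem six_le_two_rpow {d : ℝ} (hd : 4 ≤ d) : (6 : ℝ) ≤ 2 ^ (2 * d / 3) := by
  have h1 : (6 : ℝ) ≤ 2 ^ ((8 : ℝ) / 3) := by
    refine le_of_pow_le_pow_left₀ (n := 3) (by norm_num) (by positivity) ?_
    rw [← Real.rpow_natCast, ← Real.rpow_natCast, ← Real.rpow_mul (by norm_num)]
    norm_num
  refine h1.trans (Real.rpow_le_rpow_of_exponent_le (by norm_num) (by linarith))

theorem rounding_bounds {d : ℝ} {k : ℕ} (hd : 4 ≤ d)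
    (hk : k = ⌈(2 : ℝ) ^ (2 * d / 3)⌉₊ ∨ k = ⌊(2 : ℝ) ^ (2 * d / 3)⌋₊) :
    1 ≤ k ∧ (k : ℝ) ≤ 2 ^ (2 * d / 3) + 1 := by
  have h6 := six_le_two_rpow hd
  rcases hk with rfl | rfl
  · exact ⟨Nat.one_le_iff_ne_zero.2 (Nat.ceil_pos.2 (by linarith)).ne',
      (Nat.ceil_lt_add_one (by linarith)).le⟩
  · exact ⟨Nat.le_floor (by push_cast; linarith), (Nat.floor_le (by linarith)).trans (by linarith)⟩

theorem one_add_log_le {d : ℝ} {k : ℕ} (hd : 4 ≤ d) (hk1 : 1 ≤ k)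
    (hk : (k : ℝ) ≤ 2 ^ (2 * d / 3) + 1) : 1 + Real.log k ≤ 0.76 * d := by
  have h6 := six_le_two_rpow hd
  set M : ℝ := 2 ^ (2 * d / 3) with hM
  have hM0 : 0 < M := by linarith
  have hlogM : Real.log M = 2 * d / 3 * Real.log 2 := Real.log_rpow (by norm_num) _
  have h1 : Real.log k ≤ Real.log M + 1 / 6 := by
    calc Real.log k ≤ Real.log (M * (1 + 1 / M)) := by
          refine Real.log_le_log (by exact_mod_cast hk1) (hk.trans_eq ?_)
          field_simp
      _ = Real.log M + Real.log (1 + 1 / M) := Real.log_mul (by positivity) (by positivity)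
      _ ≤ Real.log M + 1 / M := by
          have := Real.log_le_sub_one_of_pos (show 0 < 1 + 1 / M by positivity)
          linarith
      _ ≤ Real.log M + 1 / 6 := by gcongr
  have h2 := Real.log_two_lt_d9
  rw [hlogM] at h1
  nlinarith

theorem sum_range_pow_mul_le (n j : ℕ) :
    (∑ t ∈ Finset.range n, (t : ℝ) ^ j) * (j + 1) ≤ (n : ℝ) ^ (j + 1) := by
  have key : ∀ t j : ℕ, (t : ℝ) ^ (j + 1) + (j + 1) * (t : ℝ) ^ j ≤ ((t : ℝ) + 1) ^ (j + 1) := by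
    intro t j
    induction j with
    | zero => simp
    | succ j ih =>
      rw [pow_succ ((t : ℝ) + 1)]
      refine le_trans ?_ (mul_le_mul_of_nonneg_right ih (by positivity))
      have : 0 ≤ ((j : ℝ) + 1) * (t : ℝ) ^ j := by positivity
      push_cast
      rw [pow_succ (t : ℝ) (j + 1), pow_succ (t : ℝ) j] at *
      nlinarith
  induction n with
  | zero => simp
  | succ n ih =>
    rw [Finset.sum_range_succ, add_mul]
    have := key n j
    push_cast
    linarith

/-- The expected numbers of probes, each at most a truncated geometric series, add up to at most
`n` times a harmonic number. -/
theorem sum_sum_pow_le {n : ℕ} (hn : 1 ≤ n) (k : ℕ) :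
    ∑ r ∈ Finset.range n, ∑ j ∈ Finset.range k, (((n - (r + 1) : ℕ) : ℝ) / n) ^ j
      ≤ n * (1 + Real.log k) := by
  have hn0 : (0 : ℝ) < n := by exact_mod_cast hn
  rw [Finset.sum_comm]
  calc _ ≤ ∑ j ∈ Finset.range k, n * ((j : ℝ) + 1)⁻¹ := by
        refine Finset.sum_le_sum fun j _ => ?_
        have hr := Finset.sum_range_reflect (fun t => ((t : ℝ) / n) ^ j) n
        have hrefl : ∑ r ∈ Finset.range n, (((n - (r + 1) : ℕ) : ℝ) / n) ^ j
            = ∑ t ∈ Finset.range n, ((t : ℝ) / n) ^ j := by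
          rw [← hr]
          refine Finset.sum_congr rfl fun r _ => ?_
          rw [Nat.sub_sub, add_comm 1 r]
        rw [hrefl]
        simp only [div_pow]
        rw [← Finset.sum_div, div_le_iff₀ (by positivity), ← div_eq_mul_inv, div_mul_eq_mul_div,
          le_div_iff₀ (by positivity), ← pow_succ']
        exact sum_range_pow_mul_le n j
    _ = n * (harmonic k : ℝ) := by
        rw [← Finset.mul_sum, harmonic]
        push_cast
        rfl
    _ ≤ n * (1 + Real.log k) := by
        gcongr
        exact harmonic_le_one_add_log k

theorem prod_ratio_le {n : ℕ} (hn : 1 ≤ n) :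
    ∏ r ∈ Finset.range n, ((2 * r + 2 : ℝ) / (2 * r + 1)) ≤ 2 * Real.sqrt n := by
  have key : (∏ r ∈ Finset.range n, ((2 * r + 2 : ℝ) / (2 * r + 1))) ^ 2 ≤ 4 * n := by
    induction n, hn using Nat.le_induction with
    | base => norm_num
    | succ n hn ih =>
      rw [Finset.prod_range_succ, mul_pow]
      calc _ ≤ (4 * n : ℝ) * ((2 * n + 2 : ℝ) / (2 * n + 1)) ^ 2 := by gcongr
        _ ≤ 4 * ((n + 1 : ℕ) : ℝ) := by
          rw [div_pow, mul_div_assoc', div_le_iff₀ (by positivity)]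
          push_cast
          nlinarith [show (0 : ℝ) ≤ n from n.cast_nonneg]
  refine abs_le_of_sq_le_sq' ?_ (by positivity) |>.2
  rw [mul_pow, Real.sq_sqrt (by positivity)]
  linarith

/-! ### The total number of probes -/

section TotalProbes

variable {n k : ℕ} (tie : TieRule n)

theorem numGE_init_add (n : ℕ) : numGE (State.init n).load 1 + n ≤ n := by
  simp [numGE, State.init]

theorem expect_totalProbes_le (hn : 1 ≤ n) :
    𝔼 ω : Fin n → Fin k → Fin n, (totalProbes tie ω : ℝ) ≤ n * (1 + Real.log k) := by
  have : NeZero n := ⟨by omega⟩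
  refine (expect_total_le tie n (State.init n) (numGE_init_add n)).trans ?_
  simpa [State.total, State.init] using sum_sum_pow_le hn k

/-- The exponential Markov inequality for the total number of probes, given a bound `c r` for the
moment generating function of the probes of the ball after which `r` balls remain. -/
theorem totalProbes_tail_le [NeZero n] {θ : ℝ} (hθ : 0 ≤ θ) {c : ℕ → ℝ} (hc0 : ∀ r, 0 ≤ c r)
    (hc : ∀ (load : Fin n → ℕ) pick r, numGE load 1 + (r + 1) ≤ n →
      𝔼 p : Fin k → Fin n, Real.exp θ ^ (probeLoop load pick [] (List.ofFn p)).2.length ≤ c r)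
    (d : ℝ) :
    (probeLaw n k n).real {ω : Fin n → Fin k → Fin n | d < (totalProbes tie ω : ℝ) / n}
      ≤ Real.exp (-(θ * (d * n))) * ∏ r ∈ Finset.range n, c r := by
  have hn : (0 : ℝ) < n := by exact_mod_cast NeZero.pos n
  have key := expect_pow_total_le (k := k) tie (Real.one_le_exp hθ) hc0 hc n (State.init n)
    (numGE_init_add n)
  refine (probeLaw_real_le_expect (f := fun ω => Real.exp (-(θ * (d * n)))
    * Real.exp θ ^ totalProbes tie ω) (fun ω => by positivity) ?_).trans ?_
  · intro ω hω
    rw [Set.mem_ofPred_eq, lt_div_iff₀ hn] at hω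
    rw [← Real.exp_nat_mul, ← Real.exp_add, Real.one_le_exp_iff]
    nlinarith
  · rw [← Finset.mul_expect]
    gcongr
    refine key.trans_eq ?_
    simp [State.total, State.init]

theorem totalProbes_tail_le_div {d : ℝ} (hn : 1 ≤ n) (hd : 4 ≤ d) (hk1 : 1 ≤ k)
    (hk : (k : ℝ) ≤ 2 ^ (2 * d / 3) + 1) :
    (probeLaw n k n).real {ω : Fin n → Fin k → Fin n | d < (totalProbes tie ω : ℝ) / n}
      ≤ 20 * k / n := by
  have : NeZero n := ⟨by omega⟩
  have hn0 : (0 : ℝ) < n := by exact_mod_cast hn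
  have hk0 : (0 : ℝ) < k := by exact_mod_cast hk1
  set θ : ℝ := 1 / (4 * k) with hθ
  have hθ0 : 0 < θ := by positivity
  set S : ℕ → ℝ := fun r => ∑ j ∈ Finset.range k, (((n - (r + 1) : ℕ) : ℝ) / n) ^ j with hS
  -- A ball makes at most `k` probes, so `x = θ * length` is at most `1 / 4`, and
  -- `exp x ≤ 1 + 5 x / 4` for `0 ≤ x ≤ 1 / 4`.
  refine (totalProbes_tail_le tie hθ0.le (c := fun r => Real.exp (5 / 4 * θ * S r))
    (fun r => (Real.exp_pos _).le) ?_ d).trans ?_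
  · intro load pick r hr
    have hpoint : ∀ p : Fin k → Fin n,
        Real.exp θ ^ (probeLoop load pick [] (List.ofFn p)).2.length
        ≤ 1 + 5 / 4 * θ * ((probeLoop load pick [] (List.ofFn p)).2.length : ℝ) := by
      intro p
      have hlen := length_probeLoop_le load pick [] (List.ofFn p)
      simp only [List.length_nil, List.length_ofFn, zero_add] at hlen
      have hlen' : ((probeLoop load pick [] (List.ofFn p)).2.length : ℝ) ≤ k := by
        exact_mod_cast hlen
      set l : ℝ := ((probeLoop load pick [] (List.ofFn p)).2.length : ℝ) with hl
      have hl0 : 0 ≤ l := by positivity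
      have hx : l * θ ≤ 1 / 4 := by
        calc l * θ ≤ k * θ := by gcongr
          _ = 1 / 4 := by rw [hθ]; field_simp
      have hx0 : 0 ≤ l * θ := by positivity
      rw [← Real.exp_nat_mul, ← hl]
      have := abs_le.1 (Real.abs_exp_sub_one_sub_id_le (abs_le.2
        ⟨by linarith, by linarith⟩ : |l * θ| ≤ 1))
      nlinarith [this.2]
    refine (expect_mono hpoint).trans ?_
    rw [Finset.expect_add_distrib, Fintype.expect_const, ← Finset.mul_expect]
    have h1 := expect_length_probeLoop_le load pick k []
    have h2 : ∑ j ∈ Finset.range k, freq load 1 ^ j ≤ S r :=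
      Finset.sum_le_sum fun j _ => pow_le_pow_left₀ (freq_nonneg _ _) (freq_one_le hr) j
    simp only [List.length_nil, Nat.cast_zero, zero_add] at h1
    calc _ ≤ 1 + 5 / 4 * θ * S r := by
          gcongr
          exact h1.trans h2
      _ ≤ _ := by linarith [Real.add_one_le_exp (5 / 4 * θ * S r)]
  · rw [← Real.exp_sum, ← Finset.mul_sum, ← Real.exp_add]
    have hsum : ∑ r ∈ Finset.range n, S r ≤ n * (0.76 * d) :=
      (sum_sum_pow_le hn k).trans (by gcongr; exact one_add_log_le hd hk1 hk)
    have h1 : 5 / 4 * θ * ∑ r ∈ Finset.range n, S r ≤ 5 / 4 * θ * (n * (0.76 * d)) := by gcongr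
    have h2 : θ * n * 4 ≤ θ * n * d := by gcongr
    have hz : 0 < (n : ℝ) / (20 * k) := by positivity
    have h3 : (n : ℝ) / (20 * k) = θ * n / 5 := by rw [hθ]; field_simp; norm_num
    calc _ ≤ Real.exp (-((n : ℝ) / (20 * k))) := by
          refine Real.exp_le_exp.2 ?_
          rw [h3]
          linarith
      _ ≤ ((n : ℝ) / (20 * k))⁻¹ := by
          rw [Real.exp_neg]
          gcongr
          linarith [Real.add_one_le_exp ((n : ℝ) / (20 * k))]
      _ = _ := by rw [inv_div]

/-- The coupon collector's bound, in which the limit of `k` probes plays no role.  With `s = r + 1`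
balls remaining, `2 s / (2 s - 1)` is a supersolution for the moment generating function at
`w = 1 + 1 / (2 n)`. -/
theorem totalProbes_tail_le_sqrt_mul {d : ℝ} (hn : 1 ≤ n) (hd : 0 ≤ d) :
    (probeLaw n k n).real {ω : Fin n → Fin k → Fin n | d < (totalProbes tie ω : ℝ) / n}
      ≤ 2 * Real.sqrt n * 2 ^ (-(d / 2)) := by
  have : NeZero n := ⟨by omega⟩
  have hn0 : (0 : ℝ) < n := by exact_mod_cast hn
  set w : ℝ := 1 + 1 / (2 * n) with hw
  have hw1 : 1 ≤ w := by rw [hw]; linarith [show (0 : ℝ) < 1 / (2 * n) by positivity]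
  have hexp : Real.exp (Real.log w) = w := Real.exp_log (by linarith)
  refine (totalProbes_tail_le tie (Real.log_nonneg hw1)
    (c := fun r => (2 * r + 2 : ℝ) / (2 * r + 1)) (fun r => by positivity) ?_ d).trans ?_
  · intro load pick r hr
    rw [hexp]
    have hg : (2 * r + 2 : ℝ) / (2 * r + 1) = 1 + 1 / (2 * r + 1) := by field_simp; ring
    have := expect_pow_length_probeLoop_le load pick (g := (2 * r + 2 : ℝ) / (2 * r + 1)) hw1
      (by rw [hg]; linarith [show (0 : ℝ) < 1 / (2 * r + 1) by positivity]) ?_ k []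
    · simpa using this
    · have hx := freq_one_le hr
      rw [Nat.cast_sub (by omega)] at hx
      calc w * (1 + ((2 * r + 2 : ℝ) / (2 * r + 1) - 1) * freq load 1)
          = w * (1 + 1 / (2 * r + 1) * freq load 1) := by rw [hg]; ring
        _ ≤ w * (1 + 1 / (2 * r + 1) * (((n : ℝ) - ((r + 1 : ℕ) : ℝ)) / n)) := by gcongr
        _ = (2 * r + 2 : ℝ) / (2 * r + 1) - (r + 1) / (2 * n ^ 2 * (2 * r + 1)) := by
            rw [hw]; push_cast; field_simp; ring
        _ ≤ _ := by
            have : 0 ≤ ((r : ℝ) + 1) / (2 * n ^ 2 * (2 * r + 1)) := by positivity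
            linarith
  · rw [mul_comm]
    refine mul_le_mul (prod_ratio_le hn) ?_ (by positivity) (by positivity)
    rw [Real.rpow_def_of_pos (by norm_num)]
    refine Real.exp_le_exp.2 ?_
    -- `(1 + 1 / (2 n)) ^ n ≥ 3 / 2 ≥ √2`
    have h1 : Real.log 2 / 2 ≤ n * Real.log w := by
      have hb := one_add_mul_le_pow (show (-2 : ℝ) ≤ 1 / (2 * n) by
        linarith [show (0 : ℝ) < 1 / (2 * n) by positivity]) n
      rw [← hw, show (n : ℝ) * (1 / (2 * n)) = 1 / 2 by field_simp] at hb
      have h2 : (2 : ℝ) ≤ (w ^ n) ^ 2 := by nlinarith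
      have h3 := Real.log_le_log (by norm_num) h2
      rw [Real.log_pow, Real.log_pow] at h3
      push_cast at h3
      linarith
    nlinarith

/-- For `k ≤ n ^ (4 / 5)` the truncation at `k` probes gives concentration; for larger `k` the
allowance `d` exceeds a multiple of `log n` that suffices even without truncation. -/
theorem totalProbes_tail {d : ℝ} (hn : 1 ≤ n) (hd : 4 ≤ d) (hk1 : 1 ≤ k)
    (hk : (k : ℝ) ≤ 2 ^ (2 * d / 3) + 1) :
    (probeLaw n k n).real {ω : Fin n → Fin k → Fin n | d < (totalProbes tie ω : ℝ) / n}
      ≤ 20 * (n : ℝ) ^ (-(1 / 10 : ℝ)) := by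
  have hn0 : (0 : ℝ) < n := by exact_mod_cast hn
  have hn1 : (1 : ℝ) ≤ n := by exact_mod_cast hn
  rcases le_total (k : ℝ) ((n : ℝ) ^ (4 / 5 : ℝ)) with h | h
  · refine (totalProbes_tail_le_div tie hn hd hk1 hk).trans ?_
    calc 20 * (k : ℝ) / n ≤ 20 * (n : ℝ) ^ (4 / 5 : ℝ) / n := by gcongr
      _ = 20 * (n : ℝ) ^ (4 / 5 - 1 : ℝ) := by rw [Real.rpow_sub hn0, Real.rpow_one, mul_div_assoc]
      _ ≤ _ := by
          refine mul_le_mul_of_nonneg_left ?_ (by norm_num)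
          exact Real.rpow_le_rpow_of_exponent_le hn1 (by norm_num)
  · refine (totalProbes_tail_le_sqrt_mul tie hn (by linarith)).trans ?_
    have h6 := six_le_two_rpow hd
    have hM : (n : ℝ) ^ (4 / 5 : ℝ) / 2 ≤ 2 ^ (2 * d / 3) := by linarith
    have h1 : (n : ℝ) ^ (3 / 5 : ℝ) / 2 ≤ 2 ^ (d / 2) := by
      calc (n : ℝ) ^ (3 / 5 : ℝ) / 2
          ≤ (n : ℝ) ^ (3 / 5 : ℝ) / 2 ^ (3 / 4 : ℝ) := by
            gcongr
            calc (2 : ℝ) ^ (3 / 4 : ℝ) ≤ 2 ^ (1 : ℝ) :=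
                  Real.rpow_le_rpow_of_exponent_le (by norm_num) (by norm_num)
              _ = 2 := Real.rpow_one 2
        _ = ((n : ℝ) ^ (4 / 5 : ℝ) / 2) ^ (3 / 4 : ℝ) := by
            rw [Real.div_rpow (by positivity) (by norm_num), ← Real.rpow_mul hn0.le]
            norm_num
        _ ≤ (2 ^ (2 * d / 3)) ^ (3 / 4 : ℝ) := by gcongr
        _ = 2 ^ (d / 2) := by
            rw [← Real.rpow_mul (by norm_num)]
            congr 1
            ring
    calc 2 * Real.sqrt n * 2 ^ (-(d / 2))
        ≤ 2 * Real.sqrt n * ((n : ℝ) ^ (3 / 5 : ℝ) / 2)⁻¹ := by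
          rw [Real.rpow_neg (by norm_num)]
          gcongr
      _ = 4 * (n : ℝ) ^ (1 / 2 - 3 / 5 : ℝ) := by
          rw [Real.sqrt_eq_rpow, Real.rpow_sub hn0, inv_div]
          ring
      _ ≤ _ := by
          refine mul_le_mul (by norm_num) ?_ (by positivity) (by norm_num)
          exact Real.rpow_le_rpow_of_exponent_le hn1 (by norm_num)

end TotalProbes

/-! ### The maximum load -/

section MaxLoad

variable {n k : ℕ} (tie : TieRule n)

theorem numGE_init (n : ℕ) {i : ℕ} (hi : 1 ≤ i) : numGE (State.init n).load i = 0 := by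
  have : i ≠ 0 := by omega
  simp [numGE, State.init, this]

/-- If at most `α n` bins reach load `i`, then at most `6 n α ^ k + μ` bins reach load `i + 1`,
up to an exponentially small probability. -/
theorem numGE_succ_tail [NeZero n] {i : ℕ} (hi : 1 ≤ i) (hk : 2 ≤ k) {α β μ : ℝ} (hα0 : 0 ≤ α)
    (hα : α ≤ 1 / 6) (hβ : 6 * n * α ^ k + μ ≤ β * n) :
    (probeLaw n k n).real {ω : Fin n → Fin k → Fin n | β * n < numGE (run tie ω).load (i + 1)}
      ≤ (probeLaw n k n).real {ω : Fin n → Fin k → Fin n | α * n < numGE (run tie ω).load i}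
        + Real.exp (-(μ / 3)) := by
  set U := {ω : Fin n → Fin k → Fin n | α * n < numGE (run tie ω).load i}
  set T := {ω : Fin n → Fin k → Fin n | (numGE (run tie ω).load i : ℝ) ≤ α * n ∧
    β * n < numGE (run tie ω).load (i + 1)} with hT
  have hsub : {ω : Fin n → Fin k → Fin n | β * n < numGE (run tie ω).load (i + 1)} ⊆ U ∪ T := by
    intro ω hω
    rcases lt_or_ge (α * n) (numGE (run tie ω).load i : ℝ) with h | h
    · exact Or.inl h
    · exact Or.inr ⟨h, hω⟩
  refine (measureReal_mono hsub).trans ((measureReal_union_le _ _).trans ?_)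
  gcongr
  refine (probeLaw_real_le_expect (f := fun ω => Real.exp (-(β * n / 3))
    * (if (numGE (run tie ω).load i : ℝ) ≤ α * n then
        Real.exp (numGE (run tie ω).load (i + 1) / 3) else 0)) ?_ ?_).trans ?_
  · intro ω
    refine mul_nonneg (Real.exp_pos _).le ?_
    split_ifs
    · exact (Real.exp_pos _).le
    · exact le_rfl
  · intro ω hω
    obtain ⟨h1, h2⟩ := hω
    rw [if_pos h1, ← Real.exp_add, Real.one_le_exp_iff]
    linarith
  · rw [← Finset.mul_expect]
    refine (mul_le_mul_of_nonneg_left (expect_exp_numGE_le tie hi hk hα0 hα n le_rfl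
      (State.init n)) (Real.exp_pos _).le).trans ?_
    rw [numGE_init n hi, numGE_init n (by omega), if_pos (by simp; positivity), ← Real.exp_add]
    refine Real.exp_le_exp.2 ?_
    push_cast
    linarith

/-- With `δ ≤ 1 / 16`, the bound on the proportion of bins of load at least `32 + j` is about
`2 ^ (- k ^ j)` until it falls below `δ`. -/
theorem numGE_level_tail [NeZero n] (hk : 2 ≤ k) {δ : ℝ} (hδ0 : 0 < δ) (hδ : δ ≤ 1 / 16) (j : ℕ) :
    (probeLaw n k n).real {ω : Fin n → Fin k → Fin n |
        max ((1 / 2) ^ k ^ j / 16) δ * n < numGE (run tie ω).load (32 + j)}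
      ≤ j * Real.exp (-(δ * n / 6)) := by
  have hn : (0 : ℝ) < n := by exact_mod_cast NeZero.pos n
  induction j with
  | zero =>
    -- The loads add up to at most `n`, so at most `n / 32` bins have load at least `32`.
    have hempty : {ω : Fin n → Fin k → Fin n |
        max ((1 / 2) ^ k ^ 0 / 16) δ * n < (numGE (run tie ω).load (32 + 0) : ℝ)} = ∅ := by
      refine Set.eq_empty_of_forall_notMem fun ω hω => ?_
      have h1 := numGE_mul_le (run tie ω).load 32
      have h2 := sum_load_runFrom_le tie (State.init n) ω
      have h3 : numGE (run tie ω).load 32 * 32 ≤ n := by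
        refine h1.trans (h2.trans ?_)
        simp [State.init]
      have h4 : (numGE (run tie ω).load 32 : ℝ) * 32 ≤ n := by exact_mod_cast h3
      have h5 : (1 / 32 : ℝ) * n ≤ max ((1 / 2) ^ k ^ 0 / 16) δ * n := by
        gcongr
        refine le_trans ?_ (le_max_left _ _)
        norm_num
      rw [Set.mem_ofPred_eq] at hω
      simp only [add_zero] at hω
      linarith
    rw [hempty]
    simp
  | succ j ih =>
    set v : ℝ := (1 / 2) ^ k ^ j with hv
    have hv0 : 0 < v := by positivity
    have hv1 : v ≤ 1 := pow_le_one₀ (by norm_num) (by norm_num)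
    have hv' : (1 / 2 : ℝ) ^ k ^ (j + 1) = v ^ k := by rw [hv, ← pow_mul, pow_succ]
    have hα0 : 0 ≤ max (v / 16) δ := hδ0.le.trans (le_max_right _ _)
    have hα : max (v / 16) δ ≤ 1 / 6 := max_le (by linarith) (by linarith)
    have hmax : 6 * max (v / 16) δ ^ k ≤ max (v ^ k / 16) δ / 2 := by
      rcases le_total (v / 16) δ with h | h
      · rw [max_eq_right h]
        have h1 : δ ^ k ≤ δ ^ 2 := pow_le_pow_of_le_one hδ0.le (by linarith) hk
        have h2 := le_max_right (v ^ k / 16) δ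
        nlinarith
      · rw [max_eq_left h, div_pow]
        have h1 : (16 : ℝ) ^ 2 ≤ 16 ^ k := pow_le_pow_right₀ (by norm_num) hk
        have h2 := le_max_left (v ^ k / 16) δ
        have h3 : v ^ k / 16 ^ k ≤ v ^ k / 16 ^ 2 := by gcongr
        have h4 : 0 < v ^ k := by positivity
        linarith
    have hβ : 6 * n * max (v / 16) δ ^ k + δ * n / 2 ≤ max (v ^ k / 16) δ * n := by
      have h2 := le_max_right (v ^ k / 16) δ
      nlinarith
    have step := numGE_succ_tail tie (i := 32 + j) (by omega) hk hα0 hα hβ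
    rw [hv']
    refine step.trans ?_
    push_cast
    rw [add_one_mul, show δ * (n : ℝ) / 2 / 3 = δ * n / 6 by ring]
    gcongr

/-- After `J` levels at most `n ^ (3 / 4)` bins are left, and with `α = n ^ (- 1 / 4)` one further
level is reached with probability at most `n α ^ k ≤ n ^ (- 3 / 4)`, as `k ≥ 7`. -/
theorem maxLoad_tail_le_add (hn : 65536 ≤ n) (hk : 7 ≤ k) {J : ℕ} (hJ : (n : ℝ) ≤ 2 ^ k ^ J) :
    (probeLaw n k n).real {ω : Fin n → Fin k → Fin n | 32 + J < maxLoad tie ω}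
      ≤ J * Real.exp (-((n : ℝ) ^ (3 / 4 : ℝ) / 6)) + (n : ℝ) ^ (-(3 / 4) : ℝ) := by
  have : NeZero n := ⟨by omega⟩
  have hn0 : (0 : ℝ) < n := by exact_mod_cast NeZero.pos n
  have hn1 : (1 : ℝ) ≤ n := by exact_mod_cast NeZero.pos n
  set δ : ℝ := (n : ℝ) ^ (-(1 / 4) : ℝ) with hδ
  have hδ0 : 0 < δ := by positivity
  have hδ16 : δ ≤ 1 / 16 := by
    have h1 : (16 : ℝ) ≤ (n : ℝ) ^ (1 / 4 : ℝ) := by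
      calc (16 : ℝ) = (65536 : ℝ) ^ (1 / 4 : ℝ) := by
            rw [show (65536 : ℝ) = 16 ^ (4 : ℝ) by norm_num, ← Real.rpow_mul (by norm_num)]
            norm_num
        _ ≤ _ := by
            gcongr
            exact_mod_cast hn
    rw [hδ, Real.rpow_neg hn0.le, one_div (16 : ℝ)]
    gcongr
  have hδn : δ * n = (n : ℝ) ^ (3 / 4 : ℝ) := by
    rw [hδ, ← Real.rpow_add_one hn0.ne']
    norm_num
  have hsmall : max ((1 / 2 : ℝ) ^ k ^ J / 16) δ = δ := by
    refine max_eq_right ?_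
    have h1 : (1 / 2 : ℝ) ^ k ^ J ≤ (n : ℝ)⁻¹ := by
      rw [one_div, inv_pow]
      gcongr
    have h2 : (n : ℝ)⁻¹ ≤ δ := by
      rw [← Real.rpow_neg_one]
      exact Real.rpow_le_rpow_of_exponent_le hn1 (by norm_num)
    have h3 : 0 < (1 / 2 : ℝ) ^ k ^ J := by positivity
    linarith
  have hlevel := numGE_level_tail tie (by omega : 2 ≤ k) hδ0 hδ16 J
  rw [hsmall, hδn] at hlevel
  set U := {ω : Fin n → Fin k → Fin n |
    (n : ℝ) ^ (3 / 4 : ℝ) < (numGE (run tie ω).load (32 + J) : ℝ)} with hU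
  set T := {ω : Fin n → Fin k → Fin n |
    (numGE (run tie ω).load (32 + J) : ℝ) ≤ δ * n ∧ 1 ≤ numGE (run tie ω).load (32 + J + 1)}
    with hT
  have hsub : {ω : Fin n → Fin k → Fin n | 32 + J < maxLoad tie ω} ⊆ U ∪ T := by
    intro ω hω
    rcases lt_or_ge ((n : ℝ) ^ (3 / 4 : ℝ)) (numGE (run tie ω).load (32 + J) : ℝ) with h | h
    · exact Or.inl h
    · refine Or.inr ⟨by rwa [hδn], ?_⟩
      obtain ⟨b, -, hb⟩ := Finset.lt_sup_iff.1 (show 32 + J < maxLoad tie ω from hω)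
      exact Finset.card_pos.2 ⟨b, Finset.mem_filter.2 ⟨Finset.mem_univ _, hb⟩⟩
  refine (measureReal_mono hsub).trans ((measureReal_union_le _ _).trans ?_)
  refine add_le_add hlevel ?_
  refine (probeLaw_real_le_expect (f := fun ω => if (numGE (run tie ω).load (32 + J) : ℝ) ≤ δ * n ∧
        1 ≤ numGE (run tie ω).load (32 + J + 1) then (1 : ℝ) else 0) ?_ ?_).trans ?_
  · intro ω
    split_ifs <;> norm_num
  · intro ω hω
    exact (if_pos (show _ ∧ _ from hω)).ge
  · refine (expect_one_le_numGE_le tie (i := 32 + J) (by omega) (by omega : 2 ≤ k) hδ0.le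
      (by linarith) n (State.init n)).trans ?_
    rw [numGE_init n (by omega)]
    calc _ = δ ^ k * n := by simp
      _ ≤ δ ^ 7 * n := by
          gcongr ?_ * _
          exact pow_le_pow_of_le_one hδ0.le (by linarith) hk
      _ = (n : ℝ) ^ (-(3 / 4) : ℝ) := by
          rw [hδ, ← Real.rpow_natCast, ← Real.rpow_mul hn0.le, ← Real.rpow_add_one hn0.ne']
          norm_num

theorem maxLoad_tail {κ : ℝ} (hn : 2 ≤ n) (hk : 7 ≤ k) (hκ1 : 1 ≤ κ)
    (hκ : (2 : ℝ) ^ κ ≤ k) :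
    (probeLaw n k n).real {ω : Fin n → Fin k → Fin n |
        Real.logb 2 (Real.logb 2 n) / κ + 33 < (maxLoad tie ω : ℝ)}
      ≤ 500 * (n : ℝ) ^ (-(1 / 2) : ℝ) := by
  have hκ0 : 0 < κ := by linarith
  have hn0 : (0 : ℝ) < n := by exact_mod_cast (by omega : 0 < n)
  have hn1 : (1 : ℝ) ≤ n := by exact_mod_cast (by omega : 1 ≤ n)
  rcases lt_or_ge n 65536 with hsmall | hlarge
  · refine (probeLaw_real_le_one _).trans ?_
    have h1 : (n : ℝ) ^ (1 / 2 : ℝ) ≤ 256 := by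
      calc (n : ℝ) ^ (1 / 2 : ℝ) ≤ (65536 : ℝ) ^ (1 / 2 : ℝ) := by
            gcongr
            exact_mod_cast hsmall.le
        _ = 256 := by
            rw [show (65536 : ℝ) = 256 ^ (2 : ℝ) by norm_num, ← Real.rpow_mul (by norm_num)]
            norm_num
    rw [Real.rpow_neg hn0.le, ← div_eq_mul_inv, le_div_iff₀ (by positivity)]
    linarith
  set l : ℝ := Real.logb 2 n with hl
  have hl1 : 1 ≤ l := by
    rw [hl, Real.le_logb_iff_rpow_le (by norm_num) hn0, Real.rpow_one]
    exact_mod_cast hn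
  have hll0 : 0 ≤ Real.logb 2 l := Real.logb_nonneg (by norm_num) hl1
  set J : ℕ := ⌈Real.logb 2 l / κ⌉₊ with hJdef
  have hJle : Real.logb 2 l / κ ≤ J := Nat.le_ceil _
  have hJlt : (J : ℝ) < Real.logb 2 l / κ + 1 := Nat.ceil_lt_add_one (by positivity)
  have hkJ : l ≤ (k : ℝ) ^ J := by
    calc l = 2 ^ Real.logb 2 l := by
          rw [Real.rpow_logb (by norm_num) (by norm_num) (by linarith)]
      _ ≤ 2 ^ (κ * J) := by
          refine Real.rpow_le_rpow_of_exponent_le (by norm_num) ?_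
          rwa [div_le_iff₀' hκ0] at hJle
      _ = ((2 : ℝ) ^ κ) ^ J := by rw [Real.rpow_mul (by norm_num), Real.rpow_natCast]
      _ ≤ _ := by gcongr
  have hJ : (n : ℝ) ≤ 2 ^ k ^ J := by
    calc (n : ℝ) = 2 ^ l := by rw [hl, Real.rpow_logb (by norm_num) (by norm_num) hn0]
      _ ≤ 2 ^ ((k ^ J : ℕ) : ℝ) := by
          refine Real.rpow_le_rpow_of_exponent_le (by norm_num) ?_
          exact_mod_cast hkJ
      _ = _ := by rw [Real.rpow_natCast]
  have hJn : (J : ℝ) ≤ 5 * n := by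
    have hlogb : ∀ x : ℝ, 1 ≤ x → Real.logb 2 x ≤ 2 * x := by
      intro x hx
      have h2 := Real.log_two_gt_d9
      rw [Real.logb, div_le_iff₀ (by linarith)]
      have := Real.log_le_sub_one_of_pos (by linarith : 0 < x)
      nlinarith
    have h1 := hlogb n hn1
    have h2 := hlogb l hl1
    have h3 : Real.logb 2 l / κ ≤ Real.logb 2 l := div_le_self hll0 hκ1
    linarith
  have hsub : {ω : Fin n → Fin k → Fin n |
      Real.logb 2 l / κ + 33 < (maxLoad tie ω : ℝ)} ⊆ {ω | 32 + J < maxLoad tie ω} := by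
    intro ω hω
    have h : Real.logb 2 l / κ + 33 < (maxLoad tie ω : ℝ) := hω
    have : ((32 + J : ℕ) : ℝ) < maxLoad tie ω := by
      push_cast
      linarith
    exact_mod_cast this
  refine (measureReal_mono hsub).trans ((maxLoad_tail_le_add tie hlarge hk hJ).trans ?_)
  set z : ℝ := (n : ℝ) ^ (3 / 4 : ℝ) with hz
  have hz0 : 0 < z := by positivity
  have hexp : Real.exp (-(z / 6)) ≤ 72 * (n : ℝ) ^ (-(3 / 2) : ℝ) := by
    have hzz : (n : ℝ) ^ (-(3 / 2) : ℝ) = (z ^ 2)⁻¹ := by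
      rw [hz, ← Real.rpow_natCast, ← Real.rpow_mul hn0.le, ← Real.rpow_neg hn0.le]
      norm_num
    have hq := Real.quadratic_le_exp_of_nonneg (show 0 ≤ z / 6 by positivity)
    rw [hzz, Real.exp_neg, ← div_eq_mul_inv, inv_le_comm₀ (Real.exp_pos _) (by positivity), inv_div]
    linarith
  calc (J : ℝ) * Real.exp (-(z / 6)) + (n : ℝ) ^ (-(3 / 4) : ℝ)
      ≤ 5 * n * (72 * (n : ℝ) ^ (-(3 / 2) : ℝ)) + (n : ℝ) ^ (-(1 / 2) : ℝ) := by
        refine add_le_add (mul_le_mul hJn hexp (Real.exp_pos _).le (by positivity)) ?_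
        exact Real.rpow_le_rpow_of_exponent_le hn1 (by norm_num)
    _ = 361 * (n : ℝ) ^ (-(1 / 2) : ℝ) := by
        rw [show (-(1 / 2) : ℝ) = -(3 / 2) + 1 by norm_num, Real.rpow_add_one hn0.ne']
        ring
    _ ≤ _ := by
        gcongr
        norm_num

end MaxLoad

end FirstDiff

theorem theorem1 :
    -- average number of probes per ball, in expectation
    (∀ (d : ℝ) (k n : ℕ) (tie : FirstDiff.TieRule n), 4 ≤ d →
      (k = ⌈(2 : ℝ) ^ (2 * d / 3)⌉₊ ∨ k = ⌊(2 : ℝ) ^ (2 * d / 3)⌋₊) → 1 ≤ n →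
      ∫ ω : Fin n → Fin k → Fin n, (FirstDiff.totalProbes tie ω : ℝ) / n
        ∂(FirstDiff.probeLaw n k n) ≤ d) ∧
    -- average number of probes per ball, with high probability
    (∃ c A : ℝ, 0 < c ∧ ∀ (d : ℝ) (k n : ℕ) (tie : FirstDiff.TieRule n), 4 ≤ d →
      (k = ⌈(2 : ℝ) ^ (2 * d / 3)⌉₊ ∨ k = ⌊(2 : ℝ) ^ (2 * d / 3)⌋₊) → 1 ≤ n →
      (FirstDiff.probeLaw n k n).real
        {ω : Fin n → Fin k → Fin n | d < (FirstDiff.totalProbes tie ω : ℝ) / n}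
        ≤ A * (n : ℝ) ^ (-c)) ∧
    -- maximum load, with high probability; rounding down is admitted only
    -- where it keeps `log k` at least `0.66 d`
    (∃ C c A : ℝ, 0 < c ∧ ∀ (d : ℝ) (k n : ℕ) (tie : FirstDiff.TieRule n), 4 ≤ d →
      (k = ⌈(2 : ℝ) ^ (2 * d / 3)⌉₊ ∨
        (k = ⌊(2 : ℝ) ^ (2 * d / 3)⌋₊ ∧ (2 : ℝ) ^ (0.66 * d) ≤ k)) →
      max 2 FirstDiff.threshold ≤ n →
      (FirstDiff.probeLaw n k n).real
        {ω : Fin n → Fin k → Fin n |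
          Real.logb 2 (Real.logb 2 n) / (0.66 * d) + C < (FirstDiff.maxLoad tie ω : ℝ)}
        ≤ A * (n : ℝ) ^ (-c)) := by
  refine ⟨?_, ⟨1 / 10, 20, by norm_num, ?_⟩, ⟨33, 1 / 2, 500, by norm_num, ?_⟩⟩
  · intro d k n tie hd hk hn
    obtain ⟨hk1, hkle⟩ := FirstDiff.rounding_bounds hd hk
    have hn0 : (0 : ℝ) < n := by exact_mod_cast hn
    rw [FirstDiff.integral_probeLaw, ← Finset.expect_div, div_le_iff₀ hn0]
    have h1 := FirstDiff.expect_totalProbes_le (k := k) tie hn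
    have h2 := FirstDiff.one_add_log_le hd hk1 hkle
    nlinarith
  · intro d k n tie hd hk hn
    obtain ⟨hk1, hkle⟩ := FirstDiff.rounding_bounds hd hk
    exact FirstDiff.totalProbes_tail tie hn hd hk1 hkle
  · intro d k n tie hd hk hn
    have hk66 : (2 : ℝ) ^ (0.66 * d) ≤ k := by
      rcases hk with rfl | ⟨-, hk⟩
      · refine le_trans ?_ (Nat.le_ceil _)
        exact Real.rpow_le_rpow_of_exponent_le (by norm_num) (by linarith)
      · exact hk
    have hk7 : 7 ≤ k := by
      -- `2 ^ (0.66 * 4) > 6`, as `6 ^ 25 < 2 ^ 66`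
      have h6 : (6 : ℝ) < 2 ^ (0.66 * d) := by
        calc (6 : ℝ) < 2 ^ (66 / 25 : ℝ) := by
              refine lt_of_pow_lt_pow_left₀ 25 (by positivity) ?_
              rw [← Real.rpow_natCast (2 ^ (66 / 25 : ℝ)), ← Real.rpow_mul (by norm_num)]
              norm_num
          _ ≤ _ := Real.rpow_le_rpow_of_exponent_le (by norm_num) (by linarith)
      have : (6 : ℝ) < k := h6.trans_le hk66
      exact_mod_cast this
    exact FirstDiff.maxLoad_tail tie ((le_max_left _ _).trans hn) hk7 (by linarith) hk66
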